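/- Let $d\ge 0$ be an integer and let $\Gamma$ be a finite simple graph with vertex set $\mathcal V$, $v=|\mathcal V|\ge d+2$. For $w\in\mathbb C^d$ put $|w|^2:=\sum_{i=1}^d w_i^2$ (no conjugation). A framework of $\Gamma$ in $\mathbb C^d$ is given by a map $\rho:\mathcal V\to\mathbb C^d$; it is generic if its $vd$ coordinates satisfy no non-zero polynomial equation with rational coefficients. Two frameworks $\rho,\sigma$ of $\Gamma$ are equivalent if $|\rho(t)-\rho(u)|^2=|\sigma(t)-\sigma(u)|^2$ for every edge $\{t,u\}$ of $\Gamma$, congruent if this holds for every pair of vertices $t,u$, and strongly congruent if there are a complex matrix $A$ with $A^{t}A=I$ and a vector $b\in\mathbb C^d$ such that $\sigma(u)=A\rho(u)+b$ for all $u\in\mathcal V$. A framework is globally rigid in $\mathbb C^d$ if it is congruent to every framework of $\Gamma$ in $\mathbb C^d$ equivalent to it, and $\Gamma$ is generically globally rigid in $\mathbb C^d$ if all its generic frameworks in $\mathbb C^d$ are globally rigid. A complex equilibrium stress matrix of $\rho$ is a symmetric complex $v\times v$ matrix $\Omega$, indexed by $\mathcal V$, such that $\Omega_{tu}=0$ whenever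 $t\ne u$ and $\{t,u\}$ is not an edge, $\sum_u\Omega_{tu}=0$ for every $t$, and $\sum_u\Omega_{tu}\,\rho(u)=0$ for every $t$. **Theorem.** Let $\rho$ be a generic framework of $\Gamma$ in $\mathbb C^d$. If $\rho$ has a complex equilibrium stress matrix of rank $v-d-1$, then $\Gamma$ is generically globally rigid in $\mathbb C^d$. Moreover, every framework of $\Gamma$ in $\mathbb C^d$ that is equivalent to $\rho$ is strongly congruent to $\rho$. -/

import Mathlib

namespace ComplexRigidity

/-- A configuration of the vertex set `V` in complex `d`-space. A framework on a graph `G` is a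
configuration of the vertices of `G`, considered together with `G`. -/
abbrev Configuration (V : Type*) (d : ℕ) : Type _ := V → Fin d → ℂ

/-- The complex squared length of a vector; no conjugation is involved. -/
def sqLength {d : ℕ} (w : Fin d → ℂ) : ℂ := ∑ i, w i ^ 2

/-- The frameworks `(p, G)` and `(q, G)` have the same complex squared edge lengths. -/
def Equivalent {V : Type*} {d : ℕ} (G : SimpleGraph V) (p q : Configuration V d) : Prop :=
  ∀ t u : V, G.Adj t u → sqLength (p t - p u) = sqLength (q t - q u)

/-- All pairs of vertices have the same complex squared distance in `p` and in `q`. -/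
def Congruent {V : Type*} {d : ℕ} (p q : Configuration V d) : Prop :=
  ∀ t u : V, sqLength (p t - p u) = sqLength (q t - q u)

/-- `q` is the image of `p` under a complex orthogonal matrix (`A * Aᵀ = 1`, with the
transpose, not the conjugate transpose) followed by a translation. -/
def StronglyCongruent {V : Type*} {d : ℕ} (p q : Configuration V d) : Prop :=
  ∃ A ∈ Matrix.orthogonalGroup (Fin d) ℂ, ∃ b : Fin d → ℂ, ∀ u : V, q u = A.mulVec (p u) + b

/-- The coordinates of `p` satisfy no non-zero polynomial equation with rational coefficients. -/
def IsGeneric {V : Type*} {d : ℕ} (p : Configuration V d) : Prop :=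
  AlgebraicIndependent ℚ (fun x : V × Fin d => p x.1 x.2)

/-- The framework `(p, G)` is globally rigid in complex `d`-space. -/
def GloballyRigid {V : Type*} {d : ℕ} (G : SimpleGraph V) (p : Configuration V d) : Prop :=
  ∀ q : Configuration V d, Equivalent G p q → Congruent p q

/-- Every generic framework of `G` in complex `d`-space is globally rigid. -/
def GenericallyGloballyRigid {V : Type*} (G : SimpleGraph V) (d : ℕ) : Prop :=
  ∀ p : Configuration V d, IsGeneric p → GloballyRigid G p

/-- `Ω` is an equilibrium stress matrix of the framework `(p, G)`: a symmetric complex matrix,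
supported on the diagonal and the edges of `G`, with zero row sums, and in equilibrium at every
vertex. As the row sums vanish, the last condition is the same as
`∑ j, Ω i j • (p j - p i) = 0`. -/
structure IsEquilibriumStressMatrix {V : Type*} [Fintype V] {d : ℕ} (G : SimpleGraph V)
    (p : Configuration V d) (Ω : Matrix V V ℂ) : Prop where
  symm : ∀ i j : V, Ω i j = Ω j i
  support : ∀ i j : V, i ≠ j → ¬ G.Adj i j → Ω i j = 0
  row_sum : ∀ i : V, ∑ j, Ω i j = 0
  equilibrium : ∀ i : V, ∑ j, Ω i j • p j = 0

end ComplexRigidity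

/-! Let σ be equivalent to the generic framework ρ. Any assignment of velocities to the coordinates
of ρ is induced by a ℚ-derivation of ℂ. Differentiating the edge equations puts the range of the
rigidity matrix of ρ inside that of σ; its rank is maximal at ρ, so the ranges agree
(`range_rigidityMatrix_eq`). Stress conditions say that Ω annihilates this range, so Ω is also a
stress of σ (`of_equivalent`).

The rank hypothesis makes ker Ω exactly the affine functions of ρ (`exists_affine`), so σ is an
affine image of ρ. For fixed u, the discrepancy between squared distances from u also lies in ker Ω;
it vanishes at u and its neighbours, which are too many generic points for a non-zero affine
function (`congruent`). Congruence then forces the linear part of the affine map to be orthogonal.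
Other generic frameworks reduce to ρ by a field automorphism of ℂ, since all the conditions are
algebraic over ℚ. -/

open Module
open scoped Matrix DualNumber

/-! ### Automorphisms and derivations with prescribed values. -/

section FieldTheory

variable {K L ι : Type*} [Field K] [Field L] [Algebra K L]

/-- Algebraically independent families extend to transcendence bases. -/
theorem AlgebraicIndependent.exists_isTranscendenceBasis_range_subset {x : ι → L}
    (hx : AlgebraicIndependent K x) :
    ∃ t : Set L, Set.range x ⊆ t ∧ IsTranscendenceBasis K ((↑) : t → L) :=
  exists_isTranscendenceBasis_superset ((algebraicIndependent_subtype_range hx.injective).2 hx)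

/-- Two finite algebraically independent families of an algebraically closed field, indexed by the
same type, are conjugate under a field automorphism. -/
theorem AlgebraicIndependent.exists_ringEquiv [IsAlgClosed L] [Finite ι] {x y : ι → L}
    (hx : AlgebraicIndependent K x) (hy : AlgebraicIndependent K y) :
    ∃ τ : L ≃+* L, ∀ i, τ (x i) = y i := by
  obtain ⟨s, hs, hsb⟩ := hx.exists_isTranscendenceBasis_range_subset
  obtain ⟨t, ht, htb⟩ := hy.exists_isTranscendenceBasis_range_subset
  obtain ⟨e₀⟩ := Cardinal.eq.1 (hsb.cardinalMk_eq htb)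
  obtain ⟨n, ⟨f⟩⟩ := Finite.exists_equiv_fin ι
  let u : Fin n ↪ t := ⟨fun i => e₀ ⟨x (f.symm i), hs ⟨_, rfl⟩⟩, fun i j h => by
    simpa [hx.injective.eq_iff] using h⟩
  let w : Fin n ↪ t := ⟨fun i => ⟨y (f.symm i), ht ⟨_, rfl⟩⟩, fun i j h => by
    simpa [hy.injective.eq_iff] using h⟩
  -- An arbitrary bijection of the bases is corrected by a permutation moving finitely many points,
  -- so that it matches `x` with `y`.
  obtain ⟨π, hπ⟩ := (Equiv.Perm.isMultiplyPretransitive t n).exists_smul_eq u w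
  let e : s ≃ t := e₀.trans π
  let := IsAlgClosed.isAlgClosure_of_transcendence_basis _ hsb
  let := IsAlgClosed.isAlgClosure_of_transcendence_basis _ htb
  let g : Algebra.adjoin K (Set.range ((↑) : s → L)) ≃ₐ[K]
      Algebra.adjoin K (Set.range ((↑) : t → L)) :=
    (hsb.1.aevalEquiv.symm.trans (MvPolynomial.renameEquiv K e)).trans htb.1.aevalEquiv
  refine ⟨IsAlgClosure.equivOfEquiv L L g.toRingEquiv, fun i => ?_⟩
  have hxi : x i ∈ s := hs ⟨i, rfl⟩
  have h₁ : hsb.1.aevalEquiv (MvPolynomial.X ⟨x i, hxi⟩) =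
      ⟨x i, Algebra.subset_adjoin ⟨⟨x i, hxi⟩, rfl⟩⟩ := by
    apply Subtype.ext; simp
  have h₂ := IsAlgClosure.equivOfEquiv_algebraMap L L g.toRingEquiv
    ⟨x i, Algebra.subset_adjoin ⟨⟨x i, hxi⟩, rfl⟩⟩
  have h₃ : (e ⟨x i, hxi⟩ : L) = y i := by
    have h : π (e₀ ⟨x (f.symm (f i)), hs ⟨_, rfl⟩⟩) = ⟨y (f.symm (f i)), ht ⟨_, rfl⟩⟩ :=
      DFunLike.congr_fun hπ (f i)
    simp only [Equiv.symm_apply_apply] at h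
    exact congrArg Subtype.val h
  refine h₂.trans ?_
  rw [← h₁]
  simp [g, h₃]

open scoped IntermediateField.algebraAdjoinAdjoin in
/-- In characteristic zero, a field is formally smooth over the polynomial ring generated by a
transcendence basis. -/
theorem IsTranscendenceBasis.formallySmooth_adjoin [CharZero K] {v : ι → L}
    (hv : IsTranscendenceBasis K v) :
    Algebra.FormallySmooth (Algebra.adjoin K (Set.range v)) L := by
  have : Algebra.FormallySmooth (Algebra.adjoin K (Set.range v))
      (IntermediateField.adjoin K (Set.range v)) :=
    .of_isLocalization (nonZeroDivisors _)
  have : Algebra.IsAlgebraic (IntermediateField.adjoin K (Set.range v)) L :=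
    hv.isAlgebraic_field
  have : CharZero (IntermediateField.adjoin K (Set.range v)) :=
    charZero_of_injective_algebraMap (algebraMap K _).injective
  have : Algebra.FormallyEtale (IntermediateField.adjoin K (Set.range v)) L :=
    Algebra.FormallyEtale.of_isSeparable _ L
  exact .comp _ (IntermediateField.adjoin K (Set.range v)) _

theorem DualNumber.isNilpotent_ker_fstHom :
    IsNilpotent (RingHom.ker (TrivSqZeroExt.fstHom K L L)) := by
  refine ⟨2, le_bot_iff.1 ?_⟩
  rw [Submodule.pow_succ, Submodule.pow_one]
  refine Ideal.mul_le.2 fun a ha b hb => ?_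
  have ha : a.fst = 0 := ha
  have hb : b.fst = 0 := hb
  rw [Ideal.mem_bot]
  ext <;> simp [ha, hb]

/-- The infinitesimal part of a section of `L[ε] → L` is a derivation. -/
theorem DualNumber.exists_derivation_eq_snd (φ : L →ₐ[K] L[ε]) (hφ : ∀ z, (φ z).fst = z) :
    ∃ D : Derivation K L L, ∀ z, D z = (φ z).snd :=
  ⟨Derivation.mk' ((TrivSqZeroExt.sndHom L L).restrictScalars K ∘ₗ φ.toLinearMap) fun z w => by
    have h : (φ (z * w)).snd = z * (φ w).snd + (φ z).snd * w := by
      rw [map_mul, DualNumber.snd_mul, hφ, hφ]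
    rw [mul_comm (φ z).snd] at h
    exact h, fun _ => rfl⟩

/-- In characteristic zero there are derivations with prescribed values on an algebraically
independent family. -/
theorem AlgebraicIndependent.exists_derivation [CharZero K] {x : ι → L}
    (hx : AlgebraicIndependent K x) (η : ι → L) :
    ∃ D : Derivation K L L, ∀ i, D (x i) = η i := by
  obtain ⟨t, ht, htb⟩ := hx.exists_isTranscendenceBasis_range_subset
  -- Basis elements outside the family get derivative zero.
  let ξ : t → L := fun b => Function.extend x η 0 b
  let A := Algebra.adjoin K (Set.range ((↑) : t → L))
  have := htb.formallySmooth_adjoin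
  let θ : MvPolynomial t K →ₐ[K] L[ε] :=
    MvPolynomial.aeval fun b : t => (TrivSqZeroExt.inl (b : L) + TrivSqZeroExt.inr (ξ b) : L[ε])
  let ψ : A →ₐ[K] L[ε] := θ.comp htb.1.aevalEquiv.symm.toAlgHom
  have hψ : ∀ p, ψ (htb.1.aevalEquiv p) = θ p := fun p =>
    congrArg θ (htb.1.aevalEquiv.symm_apply_apply p)
  have hψ₁ : ∀ a : A, (ψ a).fst = a := by
    intro a
    obtain ⟨p, rfl⟩ := htb.1.aevalEquiv.surjective a
    have h : (TrivSqZeroExt.fstHom K L L).comp θ = MvPolynomial.aeval ((↑) : t → L) := by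
      ext b
      simp [θ]
    exact (congrArg TrivSqZeroExt.fst (hψ p)).trans
      ((DFunLike.congr_fun h p).trans (htb.1.algebraMap_aevalEquiv p).symm)
  -- With this twisted algebra structure, lifting the identity of `L` along `L[ε] → L` yields a
  -- section extending `ψ`.
  let _ : Algebra A L[ε] := ψ.toAlgebra
  let π : L[ε] →ₐ[A] L := { TrivSqZeroExt.fstHom K L L with commutes' := hψ₁ }
  have hπ : Function.Surjective π := fun z => ⟨TrivSqZeroExt.inl z, rfl⟩
  let φ : L →ₐ[A] L[ε] := Algebra.FormallySmooth.liftOfSurjective (AlgHom.id A L) π hπ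
    (DualNumber.isNilpotent_ker_fstHom (K := K))
  have hφ : ∀ z, (φ z).fst = z := fun z =>
    Algebra.FormallySmooth.liftOfSurjective_apply (AlgHom.id A L) π hπ
      (DualNumber.isNilpotent_ker_fstHom (K := K)) z
  have hφA : ∀ a : A, φ a = ψ a := φ.commutes
  obtain ⟨D, hD⟩ := DualNumber.exists_derivation_eq_snd
    (K := K) { (φ : L →+* L[ε]) with
      commutes' := fun c => (hφA (algebraMap K A c)).trans (ψ.commutes c) } hφ
  refine ⟨D, fun i => ?_⟩
  have hi : x i ∈ t := ht ⟨i, rfl⟩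
  have hA : x i ∈ A := Algebra.subset_adjoin ⟨⟨x i, hi⟩, rfl⟩
  have h : htb.1.aevalEquiv (MvPolynomial.X ⟨x i, hi⟩) = ⟨x i, hA⟩ := by
    apply Subtype.ext; simp
  have h' : φ (x i) = TrivSqZeroExt.inl (x i) + TrivSqZeroExt.inr (ξ ⟨x i, hi⟩) := by
    refine (hφA ⟨x i, hA⟩).trans ?_
    rw [← h, hψ]
    simp [θ]
  refine (hD (x i)).trans ((congrArg TrivSqZeroExt.snd h').trans ?_)
  simp [ξ, hx.injective.extend_apply]

end FieldTheory

/-! ### Minors and generic rank. -/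

section Rank

variable {K L κ m n : Type*} [Field K] [Field L] [Algebra K L]

/-- A matrix over a field has as many linearly independent columns as its rank. -/
theorem Matrix.exists_linearIndependent_col [Fintype m] [Fintype n] (A : Matrix m n L) {k : ℕ}
    (hk : A.rank = k) : ∃ c : Fin k → n, LinearIndependent L fun j => A.col (c j) := by
  rw [A.rank_eq_finrank_span_cols] at hk
  subst hk
  obtain ⟨f, hf, -, hli⟩ := Submodule.exists_fun_fin_finrank_span_eq L (Set.range A.col)
  choose c hc using hf
  exact ⟨c, by simpa only [hc] using hli⟩

/-- A matrix over a field has an invertible square submatrix of size its rank. -/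
theorem Matrix.exists_det_submatrix_ne_zero [Fintype m] [Fintype n] (A : Matrix m n L) :
    ∃ (r : Fin A.rank → m) (c : Fin A.rank → n), (A.submatrix r c).det ≠ 0 := by
  obtain ⟨c, hc⟩ := A.exists_linearIndependent_col rfl
  have hrank : (A.submatrix id c)ᵀ.rank = A.rank := by
    rw [Matrix.rank_transpose, Matrix.rank_eq_finrank_span_cols]
    exact (finrank_span_eq_card hc).trans (Fintype.card_fin _)
  obtain ⟨r, hr⟩ := (A.submatrix id c)ᵀ.exists_linearIndependent_col hrank
  exact ⟨r, c, IsUnit.ne_zero ((Matrix.isUnit_iff_isUnit_det _).1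
    (Matrix.linearIndependent_rows_iff_isUnit.1 hr))⟩

/-- The rank of a matrix of polynomials is maximal at algebraically independent points. -/
theorem AlgebraicIndependent.rank_map_aeval_le [Fintype m] [Fintype n] {x : κ → L}
    (hx : AlgebraicIndependent K x) (y : κ → L) (M : Matrix m n (MvPolynomial κ K)) :
    (M.map (MvPolynomial.aeval y)).rank ≤ (M.map (MvPolynomial.aeval x)).rank := by
  obtain ⟨r, c, h⟩ := (M.map (MvPolynomial.aeval y)).exists_det_submatrix_ne_zero
  -- A minor that survives at `y` is a non-zero polynomial, hence cannot vanish at `x`.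
  have hM : (M.submatrix r c).det ≠ 0 := by
    intro h0
    apply h
    rw [Matrix.submatrix_map, ← AlgHom.mapMatrix_apply, ← AlgHom.map_det, h0, map_zero]
  have hx' : ((M.map (MvPolynomial.aeval x)).submatrix r c).det ≠ 0 := by
    rw [Matrix.submatrix_map, ← AlgHom.mapMatrix_apply, ← AlgHom.map_det]
    exact fun h0 => hM (hx (by simpa using h0))
  calc _ = ((M.map (MvPolynomial.aeval x)).submatrix r c).rank := by
        rw [Matrix.rank_of_det_ne_zero hx', Fintype.card_fin]
    _ ≤ _ := Matrix.rank_submatrix_le _ _ _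

end Rank

/-! ### Generic points are in general position. -/

namespace ComplexRigidity

section GeneralPosition

variable {V : Type*} {d : ℕ} {p : Configuration V d}

/-- The determinant testing whether `d + 1` points are affinely independent. -/
theorem IsGeneric.det_ne_zero (hp : IsGeneric p) (e : Option (Fin d) ↪ V) :
    (Matrix.of fun a b : Option (Fin d) => b.elim 1 (p (e a))).det ≠ 0 := by
  classical
  let M : Matrix (Option (Fin d)) (Option (Fin d)) (MvPolynomial (V × Fin d) ℚ) :=
    Matrix.of fun a b => b.elim 1 fun k => MvPolynomial.X (e a, k)
  have hM : ∀ q : Configuration V d, M.map (MvPolynomial.aeval fun x => q x.1 x.2) =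
      Matrix.of fun a b : Option (Fin d) => b.elim 1 (q (e a)) := by
    intro q
    ext a b
    cases b <;> simp [M]
  have hdet : M.det ≠ 0 := by
    intro h0
    -- Test simplex: the origin and the standard basis vectors.
    let q : Configuration V d := fun u k => if u = e (some k) then 1 else 0
    have h : (M.map (MvPolynomial.aeval fun x => q x.1 x.2)).det = 0 := by
      rw [← AlgHom.mapMatrix_apply, ← AlgHom.map_det, h0, map_zero]
    rw [hM] at h
    obtain ⟨c, hc0, hc⟩ := Matrix.exists_mulVec_eq_zero_iff.2 h
    have h₁ : c none = 0 := by
      simpa [Matrix.mulVec, dotProduct, Fintype.sum_option, q] using congrFun hc none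
    have h₂ : ∀ k, c (some k) = 0 := fun k => by
      simpa [Matrix.mulVec, dotProduct, Fintype.sum_option, q, h₁] using congrFun hc (some k)
    exact hc0 (funext fun a => by cases a <;> simp [h₁, h₂])
  rw [← hM, ← AlgHom.mapMatrix_apply, ← AlgHom.map_det]
  exact fun h0 => hdet (hp (by simpa using h0))

theorem exists_embedding_range {T : Finset V} (hT : T.card = d + 1) :
    ∃ e : Option (Fin d) ↪ V, ∀ u, u ∈ T ↔ ∃ a, e a = u := by
  have e : Option (Fin d) ≃ T := Fintype.equivOfCardEq (by simp [hT])
  exact ⟨e.toEmbedding.trans (Function.Embedding.subtype _), fun u =>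
    ⟨fun hu => ⟨e.symm ⟨u, hu⟩, by simp⟩, by rintro ⟨a, rfl⟩; exact (e a).2⟩⟩

/-- An affine function vanishing on `d + 1` points of a generic configuration is zero. -/
theorem IsGeneric.affine_eq_zero (hp : IsGeneric p) {T : Finset V} (hT : d + 1 ≤ T.card)
    {c₀ : ℂ} {c : Fin d → ℂ} (h : ∀ u ∈ T, c₀ + c ⬝ᵥ p u = 0) : c₀ = 0 ∧ c = 0 := by
  obtain ⟨S, hST, hS⟩ := Finset.exists_subset_card_eq hT
  obtain ⟨e, he⟩ := exists_embedding_range hS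
  by_contra hne
  refine hp.det_ne_zero e (Matrix.exists_mulVec_eq_zero_iff.1
    ⟨fun a => a.elim c₀ c, fun h0 => hne ⟨congrFun h0 none, funext fun k => congrFun h0 (some k)⟩,
      funext fun a => ?_⟩)
  simpa [Matrix.mulVec, dotProduct, Fintype.sum_option, mul_comm] using
    h (e a) (hST ((he _).2 ⟨a, rfl⟩))

/-- Up to `d + 1` points of a generic configuration are affinely independent. -/
theorem IsGeneric.weights_eq_zero [Fintype V] (hp : IsGeneric p) (hV : d + 1 ≤ Fintype.card V)
    {T : Finset V} (hT : T.card ≤ d + 1) {w : V → ℂ} (hwT : ∀ u ∉ T, w u = 0)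
    (hw : ∑ u, w u = 0) (hwp : ∑ u, w u • p u = 0) : w = 0 := by
  classical
  obtain ⟨S, hTS, -, hS⟩ := Finset.exists_subsuperset_card_eq T.subset_univ hT (by simpa using hV)
  obtain ⟨e, he⟩ := exists_embedding_range hS
  have hwS : ∀ u ∉ S, w u = 0 := fun u hu => hwT u fun h => hu (hTS h)
  have hS' : S = Finset.univ.map e := by ext u; simp [he]
  have hsum : ∀ f : V → ℂ, ∑ a, w (e a) * f (e a) = ∑ u, w u * f u := by
    intro f
    rw [← Finset.sum_subset S.subset_univ fun u _ hu => by simp [hwS u hu], hS', Finset.sum_map]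
  by_contra hne
  have hz : (fun a => w (e a)) = 0 := by
    by_contra hne'
    refine hp.det_ne_zero e (Matrix.exists_vecMul_eq_zero_iff.1 ⟨_, hne', funext fun b => ?_⟩)
    cases b with
    | none => simpa [Matrix.vecMul, dotProduct, hw] using hsum 1
    | some k =>
      have := congrFun hwp k
      simp only [Finset.sum_apply, Pi.smul_apply, smul_eq_mul, Pi.zero_apply] at this
      simpa [Matrix.vecMul, dotProduct, this] using hsum fun u => p u k
  refine hne (funext fun u => ?_)
  by_cases hu : u ∈ S
  · obtain ⟨a, rfl⟩ := (he u).1 hu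
    exact congrFun hz a
  · exact hwS u hu

end GeneralPosition

end ComplexRigidity

/-! ### The rigidity matrix and transfer of stresses. -/

namespace ComplexRigidity

variable {V : Type*} [Fintype V] {d : ℕ} {G : SimpleGraph V}

open Classical in
/-- The rigidity matrix, with a row for each ordered pair of vertices; the rows of non-adjacent
pairs are zero. -/
noncomputable def rigidityMatrix {R : Type*} [CommRing R] (G : SimpleGraph V) (p : V → Fin d → R) :
    Matrix (V × V) (V × Fin d) R :=
  Matrix.of fun e x => if G.Adj e.1 e.2 then
    (p e.1 x.2 - p e.2 x.2) * ((if x.1 = e.1 then 1 else 0) - (if x.1 = e.2 then 1 else 0)) else 0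

open Classical in
theorem rigidityMatrix_mulVec {R : Type*} [CommRing R] (p : V → Fin d → R) (η : V × Fin d → R)
    (e : V × V) : (rigidityMatrix G p *ᵥ η) e = if G.Adj e.1 e.2 then
      ∑ k, (p e.1 k - p e.2 k) * (η (e.1, k) - η (e.2, k)) else 0 := by
  split_ifs with h
  · simp only [Matrix.mulVec, dotProduct, rigidityMatrix, Matrix.of_apply, if_pos h,
      Fintype.sum_prod_type_right]
    refine Finset.sum_congr rfl fun k _ => ?_
    simp [mul_assoc, ← Finset.mul_sum, sub_mul, Finset.sum_sub_distrib]
  · simp [Matrix.mulVec, dotProduct, rigidityMatrix, h]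

theorem rank_rigidityMatrix_le {p : Configuration V d} (hp : IsGeneric p) (q : Configuration V d) :
    (rigidityMatrix G q).rank ≤ (rigidityMatrix G p).rank := by
  have key : ∀ r : Configuration V d,
      (rigidityMatrix G fun u k => (MvPolynomial.X (u, k) : MvPolynomial (V × Fin d) ℚ)).map
        (MvPolynomial.aeval fun x : V × Fin d => r x.1 x.2) = rigidityMatrix G r := by
    intro r
    ext e x
    simp only [rigidityMatrix, Matrix.map_apply, Matrix.of_apply]
    split_ifs <;> simp
  have := hp.rank_map_aeval_le (fun x => q x.1 x.2)
    (rigidityMatrix G fun u k => (MvPolynomial.X (u, k) : MvPolynomial (V × Fin d) ℚ))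
  rwa [key, key p] at this

/-- The derivative of the squared length along a derivation. -/
theorem derivation_sqLength (D : Derivation ℚ ℂ ℂ) (w : Fin d → ℂ) :
    D (sqLength w) = 2 * ∑ k, w k * D (w k) := by
  simp only [sqLength, map_sum, Derivation.leibniz_pow, Finset.mul_sum]
  exact Finset.sum_congr rfl fun k _ => by simp

/-- Equivalent frameworks, the first of which is generic, have the same infinitesimal changes of
squared edge lengths. -/
theorem range_rigidityMatrix_eq {p q : Configuration V d} (hp : IsGeneric p)
    (hpq : Equivalent G p q) :
    LinearMap.range (rigidityMatrix G p).mulVecLin =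
      LinearMap.range (rigidityMatrix G q).mulVecLin := by
  refine Submodule.eq_of_le_of_finrank_le ?_ (rank_rigidityMatrix_le hp q)
  rintro _ ⟨η, rfl⟩
  obtain ⟨D, hD⟩ := hp.exists_derivation η
  -- Applying `D` to both sides of an edge equation shows that the velocities `D q` produce the same
  -- edge changes as `η`.
  refine ⟨fun x => D (q x.1 x.2), funext fun e => ?_⟩
  simp only [Matrix.mulVecLin_apply, rigidityMatrix_mulVec]
  split_ifs with h
  · have := congrArg D (hpq _ _ h)
    simp only [derivation_sqLength, Pi.sub_apply, map_sub] at this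
    simpa [← hD] using this.symm
  · rfl

/-- The pairing of a stress matrix with an infinitesimal change of squared edge lengths. -/
theorem sum_mul_rigidityMatrix_mulVec {Ω : Matrix V V ℂ} (symm : ∀ i j, Ω i j = Ω j i)
    (support : ∀ i j : V, i ≠ j → ¬ G.Adj i j → Ω i j = 0) (row_sum : ∀ i, ∑ j, Ω i j = 0)
    (p : Configuration V d) (η : V × Fin d → ℂ) :
    ∑ e : V × V, Ω e.1 e.2 * (rigidityMatrix G p *ᵥ η) e =
      -2 * ∑ i, ∑ k, η (i, k) * ∑ j, Ω i j * p j k := by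
  classical
  have h₁ : ∀ e : V × V, Ω e.1 e.2 * (rigidityMatrix G p *ᵥ η) e =
      ∑ k, Ω e.1 e.2 * ((p e.1 k - p e.2 k) * (η (e.1, k) - η (e.2, k))) := by
    rintro ⟨i, j⟩
    rw [rigidityMatrix_mulVec, ← Finset.mul_sum]
    split_ifs with h
    · rfl
    · rcases eq_or_ne i j with rfl | hij
      · simp
      · simp [support i j hij h]
  have col_sum : ∀ j, ∑ i, Ω i j = 0 := fun j => by simpa only [symm] using row_sum j
  simp only [h₁]
  rw [Finset.sum_comm, Finset.sum_comm (s := Finset.univ (α := V)), Finset.mul_sum]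
  refine Finset.sum_congr rfl fun k _ => ?_
  rw [Fintype.sum_prod_type]
  have h₂ : ∑ i, ∑ j, Ω i j * (p i k * η (i, k)) = 0 := by
    simp [← Finset.sum_mul, row_sum]
  have h₃ : ∑ i, ∑ j, Ω i j * (p j k * η (j, k)) = 0 := by
    rw [Finset.sum_comm]; simp [← Finset.sum_mul, col_sum]
  have h₄ : ∑ i, ∑ j, Ω i j * (p j k * η (i, k)) = ∑ i, η (i, k) * ∑ j, Ω i j * p j k := by
    simp only [Finset.mul_sum]
    exact Finset.sum_congr rfl fun i _ => Finset.sum_congr rfl fun j _ => by ring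
  have h₅ : ∑ i, ∑ j, Ω i j * (p i k * η (j, k)) = ∑ i, η (i, k) * ∑ j, Ω i j * p j k := by
    rw [← h₄, Finset.sum_comm]
    exact Finset.sum_congr rfl fun i _ => Finset.sum_congr rfl fun j _ => by rw [symm]
  calc _ = ∑ i, ∑ j, (Ω i j * (p i k * η (i, k)) + Ω i j * (p j k * η (j, k))
        - Ω i j * (p j k * η (i, k)) - Ω i j * (p i k * η (j, k))) :=
        Finset.sum_congr rfl fun i _ => Finset.sum_congr rfl fun j _ => by ring
    _ = _ := by
      simp only [Finset.sum_sub_distrib, Finset.sum_add_distrib, h₂, h₃, h₄, h₅]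
      ring

theorem IsEquilibriumStressMatrix.sum_mul_eq_zero {p : Configuration V d} {Ω : Matrix V V ℂ}
    (h : IsEquilibriumStressMatrix G p Ω) (i : V) (k : Fin d) : ∑ j, Ω i j * p j k = 0 := by
  simpa using congrFun (h.equilibrium i) k

/-- A stress of a generic framework is a stress of every equivalent framework. -/
theorem IsEquilibriumStressMatrix.of_equivalent {p q : Configuration V d} {Ω : Matrix V V ℂ}
    (h : IsEquilibriumStressMatrix G p Ω) (hp : IsGeneric p) (hpq : Equivalent G p q) :
    IsEquilibriumStressMatrix G q Ω where
  symm := h.symm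
  support := h.support
  row_sum := h.row_sum
  equilibrium i := by
    classical
    funext k
    -- Moving a single coordinate of `q` isolates one scalar equilibrium equation in the pairing.
    have hmem : rigidityMatrix G q *ᵥ Pi.single (i, k) 1 ∈
        LinearMap.range (rigidityMatrix G p).mulVecLin := by
      rw [range_rigidityMatrix_eq hp hpq]
      exact ⟨_, rfl⟩
    obtain ⟨η, hη⟩ := hmem
    have h₁ := sum_mul_rigidityMatrix_mulVec h.symm h.support h.row_sum p η
    have h₂ := sum_mul_rigidityMatrix_mulVec h.symm h.support h.row_sum q (Pi.single (i, k) 1)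
    rw [← hη, Matrix.mulVecLin_apply, h₁, ← Fintype.sum_prod_type'
      (f := fun i' k' => (Pi.single (i, k) 1 : V × Fin d → ℂ) (i', k') * ∑ j, Ω i' j * q j k')] at h₂
    simpa [h.sum_mul_eq_zero, Pi.single_apply] using h₂.symm

end ComplexRigidity

/-! ### The kernel of the stress matrix, congruence and conjugation. -/

namespace ComplexRigidity

variable {V : Type*} [Fintype V] {d : ℕ} {G : SimpleGraph V}

/-- The kernel of a stress matrix of rank `v - d - 1` of a generic framework consists of the affine
functions of the position. -/
theorem IsEquilibriumStressMatrix.exists_affine {p : Configuration V d} {Ω : Matrix V V ℂ}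
    (h : IsEquilibriumStressMatrix G p Ω) (hp : IsGeneric p) (hV : d + 2 ≤ Fintype.card V)
    (hrank : Ω.rank = Fintype.card V - d - 1) {f : V → ℂ} (hf : Ω *ᵥ f = 0) :
    ∃ (c₀ : ℂ) (c : Fin d → ℂ), ∀ u, f u = c₀ + c ⬝ᵥ p u := by
  let b : Option (Fin d) → V → ℂ := fun a u => a.elim 1 (p u)
  have hb : LinearIndependent ℂ b := by
    rw [Fintype.linearIndependent_iff]
    intro g hg
    obtain ⟨h₀, h₁⟩ := hp.affine_eq_zero (T := Finset.univ) (c₀ := g none)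
      (c := fun k => g (some k)) (by rw [Finset.card_univ]; omega) fun u _ => by
        simpa [b, Fintype.sum_option, dotProduct] using congrFun hg u
    rintro (_ | k)
    exacts [h₀, congrFun h₁ k]
  have hle : Submodule.span ℂ (Set.range b) ≤ LinearMap.ker Ω.mulVecLin := by
    rw [Submodule.span_le]
    rintro _ ⟨_ | k, rfl⟩
    · exact funext fun i => by simpa [b, Matrix.mulVec, dotProduct] using h.row_sum i
    · exact funext fun i => by
        simpa [b, Matrix.mulVec, dotProduct] using h.sum_mul_eq_zero i k
  have hker := Ω.mulVecLin.finrank_range_add_finrank_ker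
  rw [finrank_pi, show finrank ℂ (LinearMap.range Ω.mulVecLin) = _ from hrank] at hker
  have heq : Submodule.span ℂ (Set.range b) = LinearMap.ker Ω.mulVecLin := by
    refine Submodule.eq_of_le_of_finrank_eq hle ?_
    rw [finrank_span_eq_card hb, Fintype.card_option, Fintype.card_fin]
    omega
  have hmem : f ∈ Submodule.span ℂ (Set.range b) := by rw [heq]; exact hf
  obtain ⟨g, rfl⟩ := (Submodule.mem_span_range_iff_exists_fun ℂ).1 hmem
  exact ⟨g none, fun k => g (some k), fun u => by
    simp [b, Fintype.sum_option, dotProduct]⟩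

open Classical in
/-- In a generic framework with a stress matrix of rank `v - d - 1`, every vertex has at least
`d + 1` neighbours. -/
theorem IsEquilibriumStressMatrix.lt_card_closedNeighborhood {p : Configuration V d}
    {Ω : Matrix V V ℂ} (h : IsEquilibriumStressMatrix G p Ω) (hp : IsGeneric p)
    (hV : d + 2 ≤ Fintype.card V) (hrank : Ω.rank = Fintype.card V - d - 1) (u : V) :
    d + 1 < (Finset.univ.filter fun t => t = u ∨ G.Adj u t).card := by
  by_contra hcard
  -- Row `u` would be an affine dependency among at most `d + 1` generic points.
  have hrow : Ω u = 0 := by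
    refine hp.weights_eq_zero (by omega) (not_lt.1 hcard) (fun t ht => ?_) (h.row_sum u)
      (h.equilibrium u)
    simp only [Finset.mem_filter, Finset.mem_univ, true_and, not_or] at ht
    exact h.support u t (Ne.symm ht.1) ht.2
  -- The indicator of `u` would then be an affine function of `p` vanishing at the other, at least
  -- `d + 1`, vertices.
  obtain ⟨c₀, c, hc⟩ := h.exists_affine hp hV hrank (f := Pi.single u 1) (by
    ext t
    simpa [h.symm t u] using congrFun hrow t)
  obtain ⟨rfl, rfl⟩ := hp.affine_eq_zero (T := Finset.univ.erase u) (c₀ := c₀) (c := c)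
    (by rw [Finset.card_erase_of_mem (Finset.mem_univ u), Finset.card_univ]; omega) fun t ht => by
      rw [← hc, Pi.single_eq_of_ne (Finset.ne_of_mem_erase ht)]
  simpa using hc u

theorem sqLength_sub (x y : Fin d → ℂ) :
    sqLength (x - y) = sqLength x + sqLength y - 2 * x ⬝ᵥ y := by
  simp only [sqLength, dotProduct, Finset.mul_sum, ← Finset.sum_add_distrib,
    ← Finset.sum_sub_distrib]
  exact Finset.sum_congr rfl fun k _ => by simp only [Pi.sub_apply]; ring

theorem IsEquilibriumStressMatrix.sum_mul_dotProduct_eq_zero {p : Configuration V d}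
    {Ω : Matrix V V ℂ} (h : IsEquilibriumStressMatrix G p Ω) (i : V) (x : Fin d → ℂ) :
    ∑ j, Ω i j * (p j ⬝ᵥ x) = 0 := by
  simp only [dotProduct, Finset.mul_sum]
  rw [Finset.sum_comm]
  refine Finset.sum_eq_zero fun k _ => ?_
  simp only [← mul_assoc]
  rw [← Finset.sum_mul, h.sum_mul_eq_zero, zero_mul]

/-- A generic framework with a stress matrix of rank `v - d - 1` is globally rigid. -/
theorem IsEquilibriumStressMatrix.congruent {p q : Configuration V d} {Ω : Matrix V V ℂ}
    (h : IsEquilibriumStressMatrix G p Ω) (hp : IsGeneric p) (hV : d + 2 ≤ Fintype.card V)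
    (hrank : Ω.rank = Fintype.card V - d - 1) (hpq : Equivalent G p q) : Congruent p q := by
  classical
  have hq := h.of_equivalent hp hpq
  let a : V → ℂ := fun u => sqLength (q u) - sqLength (p u)
  let H : V → V → ℂ := fun u t => sqLength (q t - q u) - sqLength (p t - p u)
  have hH : ∀ u t, u = t ∨ G.Adj u t → H u t = 0 := by
    rintro u t (rfl | hut)
    · simp [H]
    · simp only [H, hpq t u hut.symm, sub_self]
  -- `Ω` kills constants and linear functions of `p` and `q`, so the result does not depend on `u`;
  -- row `s` may be evaluated with base vertex `s`.
  have hΩH : ∀ s u, (Ω *ᵥ H u) s = (Ω *ᵥ a) s := by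
    intro s u
    have : ∀ t, Ω s t * H u t = Ω s t * a t + Ω s t * a u - 2 * (Ω s t * (q t ⬝ᵥ q u))
        + 2 * (Ω s t * (p t ⬝ᵥ p u)) := by
      intro t
      simp only [H, a, sqLength_sub]
      ring
    have apply : ∀ f : V → ℂ, (Ω *ᵥ f) s = ∑ t, Ω s t * f t := fun _ => rfl
    simp only [apply, this, Finset.sum_add_distrib,
      Finset.sum_sub_distrib, ← Finset.mul_sum, ← Finset.sum_mul, h.row_sum,
      h.sum_mul_dotProduct_eq_zero, hq.sum_mul_dotProduct_eq_zero]
    ring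
  have hdiag : ∀ u, (Ω *ᵥ H u) u = 0 := by
    intro u
    refine Finset.sum_eq_zero fun t _ => ?_
    change Ω u t * H u t = 0
    by_cases hut : u = t ∨ G.Adj u t
    · rw [hH u t hut, mul_zero]
    · rw [not_or] at hut
      rw [h.support u t hut.1 hut.2, zero_mul]
  have hker : ∀ u, Ω *ᵥ H u = 0 := fun u => funext fun s => by
    rw [hΩH, ← hΩH s s, hdiag, Pi.zero_apply]
  intro t u
  obtain ⟨c₀, c, hc⟩ := h.exists_affine hp hV hrank (hker u)
  obtain ⟨rfl, rfl⟩ := hp.affine_eq_zero (c₀ := c₀) (c := c)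
    (h.lt_card_closedNeighborhood hp hV hrank u).le fun s hs => by
      rw [← hc]
      simp only [Finset.mem_filter, Finset.mem_univ, true_and] at hs
      exact hH u s (hs.imp_left Eq.symm)
  have : H u t = 0 := by simpa using hc t
  exact (sub_eq_zero.1 this).symm

/-- A congruent affine image of a generic configuration is strongly congruent to it. -/
theorem IsGeneric.stronglyCongruent {p q : Configuration V d} (hp : IsGeneric p)
    (hV : d + 1 ≤ Fintype.card V) (hpq : Congruent p q) (A : Matrix (Fin d) (Fin d) ℂ)
    (b : Fin d → ℂ) (hq : ∀ u, q u = A *ᵥ p u + b) : StronglyCongruent p q := by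
  refine ⟨A, (Matrix.mem_orthogonalGroup_iff' _ _).2 ?_, b, hq⟩
  obtain ⟨o⟩ : Nonempty V := Fintype.card_pos_iff.1 (by omega)
  have inner : ∀ t u, (q t - q o) ⬝ᵥ (q u - q o) = (p t - p o) ⬝ᵥ (p u - p o) := by
    intro t u
    have h₁ := sqLength_sub (q t - q o) (q u - q o)
    have h₂ := sqLength_sub (p t - p o) (p u - p o)
    rw [sub_sub_sub_cancel_right] at h₁ h₂
    linear_combination (h₁ - h₂ + hpq t u - hpq t o - hpq u o) / 2
  -- The differences `p t - p o` span; this is used for the columns and then the rows of `Aᵀ * A -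
  -- 1`.
  have zero_of : ∀ c : Fin d → ℂ, (∀ t, c ⬝ᵥ (p t - p o) = 0) → c = 0 := fun c hc =>
    (hp.affine_eq_zero (T := Finset.univ) (c₀ := -(c ⬝ᵥ p o)) (by simpa using hV) fun t _ => by
      have := hc t
      rw [dotProduct_sub] at this
      linear_combination this).2
  have hdiff : ∀ t, q t - q o = A *ᵥ (p t - p o) := fun t => by
    rw [hq, hq, Matrix.mulVec_sub, add_sub_add_right_eq_sub]
  have hvec : ∀ u, (Aᵀ * A - 1) *ᵥ (p u - p o) = 0 := fun u => zero_of _ fun t => by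
    have := inner t u
    rw [hdiff, hdiff] at this
    rw [Matrix.sub_mulVec, sub_dotProduct, Matrix.one_mulVec, ← Matrix.mulVec_mulVec, sub_eq_zero,
      Matrix.mulVec_transpose, ← Matrix.dotProduct_mulVec, dotProduct_comm, this, dotProduct_comm]
  rw [← sub_eq_zero]
  exact funext fun k => zero_of _ fun t => congrFun (hvec t) k

/-- A generic framework with a stress matrix of rank `v - d - 1` is strongly congruent to all
equivalent frameworks. -/
theorem IsEquilibriumStressMatrix.stronglyCongruent {p q : Configuration V d} {Ω : Matrix V V ℂ}
    (h : IsEquilibriumStressMatrix G p Ω) (hp : IsGeneric p) (hV : d + 2 ≤ Fintype.card V)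
    (hrank : Ω.rank = Fintype.card V - d - 1) (hpq : Equivalent G p q) :
    StronglyCongruent p q := by
  have hq := h.of_equivalent hp hpq
  choose b A hA using fun k => h.exists_affine hp hV hrank (f := fun u => q u k)
    (funext fun i => hq.sum_mul_eq_zero i k)
  refine hp.stronglyCongruent (by omega) (h.congruent hp hV hrank hpq) A b fun u =>
    funext fun k => ?_
  rw [hA, add_comm]
  rfl

theorem sqLength_ringHom (τ : ℂ →+* ℂ) (w : Fin d → ℂ) :
    sqLength (fun k => τ (w k)) = τ (sqLength w) := by
  simp [sqLength]

/-- If one generic framework of a graph is globally rigid, then all are: any two generic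
configurations are conjugate under a field automorphism. -/
theorem IsGeneric.genericallyGloballyRigid {p : Configuration V d} (hp : IsGeneric p)
    (h : GloballyRigid G p) : GenericallyGloballyRigid G d := by
  intro p' hp' q' hq'
  -- `τ` carries `p'` to `p`, and `q'` to a framework equivalent to `p`; its injectivity brings
  -- congruence back.
  obtain ⟨τ, hτ⟩ := hp'.exists_ringEquiv hp
  have hmap : ∀ (r : Configuration V d) (t u : V),
      sqLength ((fun k => τ (r t k)) - fun k => τ (r u k)) = τ (sqLength (r t - r u)) := by
    intro r t u
    rw [← RingEquiv.coe_toRingHom, ← sqLength_ringHom]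
    exact congrArg sqLength (funext fun k => (map_sub τ _ _).symm)
  have hpτ : p = fun u k => τ (p' u k) := funext fun u => funext fun k => (hτ (u, k)).symm
  rw [hpτ] at h
  have key := h (fun u k => τ (q' u k)) fun t u htu => by rw [hmap, hmap, hq' t u htu]
  exact fun t u => τ.injective (by rw [← hmap, ← hmap]; exact key t u)

end ComplexRigidity

theorem mainTheorem6 {V : Type*} [Fintype V] (G : SimpleGraph V) (d : ℕ)
    (hv : d + 2 ≤ Fintype.card V)
    (ρ : ComplexRigidity.Configuration V d) (hρ : ComplexRigidity.IsGeneric ρ)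
    (hΩ : ∃ Ω : Matrix V V ℂ, ComplexRigidity.IsEquilibriumStressMatrix G ρ Ω ∧
      Ω.rank = Fintype.card V - d - 1) :
    ComplexRigidity.GenericallyGloballyRigid G d ∧
      ∀ σ : ComplexRigidity.Configuration V d,
        ComplexRigidity.Equivalent G ρ σ → ComplexRigidity.StronglyCongruent ρ σ := by
  obtain ⟨Ω, hstress, hrank⟩ := hΩ
  exact ⟨hρ.genericallyGloballyRigid fun _ => hstress.congruent hρ hv hrank,
    fun _ => hstress.stronglyCongruent hρ hv hrank⟩
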